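/- Let $\Phi=\{\Phi(t):t\in\mathbb Z_+\}$ be a discrete-time Markov chain on a Polish space $\mathsf X$ with Borel $\sigma$-field $\mathcal B$ and one-step transition kernel $P$. Write $Pg(x)=\int P(x,dy)g(y)$, let $P^t$ denote the $t$-fold composition of $P$, with $P^0$ the identity kernel, and let $\mathbb I_C$ denote the indicator function of $C$. Suppose that $\Phi$ is $\psi$-irreducible and aperiodic: $\psi$ is a nonzero $\sigma$-finite measure on $(\mathsf X,\mathcal B)$ such that for every $A\in\mathcal B$ with $\psi(A)>0$ and every $x\in\mathsf X$ one has $P^t(x,A)>0$ for all sufficiently large $t$, and $\psi$ is maximal, i.e. every other measure with these properties is absolutely continuous with respect to $\psi$. Call a set $C\in\mathcal B$ small if there are $\epsilon>0$, a probability measure $\nu$ on $(\mathsf X,\mathcal B)$ and a finite measure $m$ on $\mathbb Z_+$ with finite mean, $\sum_t t\,m(t)<\infty$, such that $\sum_{t\ge 0}m(t)P^t(x,A)\ge\epsilon\,\mathbb I_C(x)\,\nu(A)$ for all $x\in\mathsf X$ and $A\in\mathcal B$. Suppose that (DV2) holds for some measurable $V:\mathsf X\to(0,\infty]$ with $V(x_0)<\infty$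 for at least one $x_0\in\mathsf X$; that is, for some small set $C$ and some constants $\delta>0$ and $b<\infty$, $$\log\bigl(e^{-V}Pe^{V}\bigr)\le-\delta+b\,\mathbb I_C\qquad\text{on }\{x:V(x)<\infty\}.$$ Then there exist $\eta>0$ and a measurable function $V_0:\mathsf X\to[1,\infty]$, finite $\psi$-almost everywhere, such that (V4) holds for $V_0$; that is, for some small set $C_0$ and some constants $\delta_0>0$ and $b_0<\infty$, $$PV_0-V_0\le-\delta_0V_0+b_0\,\mathbb I_{C_0}\qquad\text{on }\{x:V_0(x)<\infty\},$$ and $V_0$ is equivalent to $v_\eta:=e^{\eta V}$ (with $e^{\infty}:=\infty$), in the sense that there is a finite constant $c$ with $V_0\le c\,v_\eta$ and $v_\eta\le c\,V_0$ on all of $\mathsf X$, i.e. $V_0\in L_\infty^{v_\eta}$ and $v_\eta\in L_\infty^{V_0}$. -/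

import Mathlib

open MeasureTheory ProbabilityTheory Filter
open scoped ENNReal NNReal

namespace MultDrift

noncomputable section

variable {X : Type*} [MeasurableSpace X]

/-- The chain with transition kernel `P` is irreducible and aperiodic with respect to `ψ`: the
nonzero `σ`-finite measure `ψ` is such that every measurable `A` with `ψ A > 0` satisfies, for
each initial condition `x`, `P ^ t (x, A) > 0` for all sufficiently large times `t`. -/
structure IsIrredAperiodicWrt (P : Kernel X X) (ψ : Measure X) : Prop where
  sigmaFinite : SigmaFinite ψ
  ne_zero : ψ ≠ 0
  eventually_pos : ∀ A : Set X, MeasurableSet A → 0 < ψ A →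
    ∀ x : X, ∀ᶠ t : ℕ in atTop, 0 < (P ^ t) x A

/-- The chain with transition kernel `P` is `ψ`-irreducible and aperiodic, where `ψ` is moreover
maximal: every other such measure is absolutely continuous with respect to `ψ`. -/
structure IsPsiIrreducibleAperiodic (P : Kernel X X) (ψ : Measure X) : Prop
    extends IsIrredAperiodicWrt P ψ where
  maximal : ∀ ψ' : Measure X, IsIrredAperiodicWrt P ψ' → ψ' ≪ ψ

/-- The function `s` and the probability measure `ν` are small: for some finite measure on the
time set with finite mean, given by its weights `m t`, one has
`∑ t, m t * P ^ t (x, A) ≥ s x * ν A` for all `x` and all measurable `A`. -/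
def IsSmallPair (P : Kernel X X) (s : X → ℝ≥0) (ν : Measure X) : Prop :=
  Measurable s ∧ IsProbabilityMeasure ν ∧
    ∃ m : ℕ → ℝ≥0∞, (∑' t, m t) < ∞ ∧ (∑' t : ℕ, (t : ℝ≥0∞) * m t) < ∞ ∧
      ∀ (x : X) (A : Set X), MeasurableSet A →
        (s x : ℝ≥0∞) * ν A ≤ ∑' t, m t * (P ^ t) x A

/-- A measurable set `C` is small if `ε 𝕀_C` is a small function for some `ε > 0`. -/
def IsSmallSet (P : Kernel X X) (C : Set X) : Prop :=
  MeasurableSet C ∧ ∃ ε : ℝ≥0, 0 < ε ∧ ∃ ν : Measure X,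
    IsSmallPair P (C.indicator fun _ => ε) ν

/-- The generator `𝓐 V = P V - V` (used only at points where `V` is finite). -/
def generator (P : Kernel X X) (V : X → ℝ≥0∞) (x : X) : EReal :=
  ((∫⁻ y, V y ∂(P x) : ℝ≥0∞) : EReal) - (V x : EReal)

/-- The nonlinear generator `𝓗 V = log (e^{-V} P e^V)` (used only at points where `V` is
finite). -/
def nonlinearGenerator (P : Kernel X X) (V : X → ℝ≥0∞) (x : X) : EReal :=
  ENNReal.log (EReal.exp (-(V x : EReal)) * ∫⁻ y, EReal.exp (V y : EReal) ∂(P x))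

/-- Condition (DV2) for `V : X → (0, ∞]`, not identically infinite:
`𝓗 V ≤ -δ + b 𝕀_C` on `{V < ∞}`, with `C` small. -/
def DV2 (P : Kernel X X) (V : X → ℝ≥0∞) : Prop :=
  Measurable V ∧ (∀ x, 0 < V x) ∧ (∃ x₀, V x₀ < ∞) ∧
    ∃ (C : Set X) (δ b : ℝ), IsSmallSet P C ∧ 0 < δ ∧
      ∀ x, V x < ∞ →
        nonlinearGenerator P V x ≤ ((-δ + C.indicator (fun _ => b) x : ℝ) : EReal)

/-- Condition (V4) for `V : X → [1, ∞]`, finite almost everywhere with respect to `ψ`: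
`𝓐 V ≤ -δ V + b 𝕀_C` on `{V < ∞}`, with `C` small. -/
def V4 (P : Kernel X X) (ψ : Measure X) (V : X → ℝ≥0∞) : Prop :=
  Measurable V ∧ (∀ x, 1 ≤ V x) ∧ (∀ᵐ x ∂ψ, V x < ∞) ∧
    ∃ (C : Set X) (δ b : ℝ), IsSmallSet P C ∧ 0 < δ ∧
      ∀ x, V x < ∞ →
        generator P V x ≤
          ((-δ : ℝ) : EReal) * (V x : EReal) + ((C.indicator (fun _ => b) x : ℝ) : EReal)

/-- The function `v_η = e^{η V}`, equal to `∞` where `V = ∞` (for `η > 0`). -/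
def expWeight (η : ℝ) (V : X → ℝ≥0∞) (x : X) : ℝ≥0∞ :=
  EReal.exp ((η : EReal) * (V x : EReal))

/-- Membership of a nonnegative, possibly infinite function `g` in the weighted space `L_∞^W`:
`g ≤ c W` for a finite constant `c`, that is, `sup g / W < ∞`. -/
def MemLInftyWeighted (W g : X → ℝ≥0∞) : Prop :=
  ∃ c : ℝ≥0, ∀ x, g x ≤ (c : ℝ≥0∞) * W x

end

end MultDrift

open scoped Topology

namespace MultDrift

variable {X : Type*} [MeasurableSpace X]

/-! With `W = e^V`, (DV2) reads `PW ≤ e^{-δ + b 𝕀_C} W` on `{W < ∞}`. This is not yet (V4): `W` may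
be unbounded on `C`, so the excess there is not an additive constant.

The excess is moved to a small set `D` on which `W` is bounded. The drift forces the chain into `C`,
and the small-set measure `ν` lives on `{W < ∞}`, so some such `D` has `ν D > 0` and is reached
uniformly from `C` (`exists_small_bounded`). Expected occupation of `D` up to the sampling time is
bounded because that time has finite mean; a multiple `H` satisfies `PH ≥ H + b 𝕀_C - K 𝕀_D`
(`exists_bounded_drift`).

The new weight is `U = W^η e^{η(B - H)}`, where `H ≤ B`. Hölder's inequality replaces `P e^{-ηH}` by
`e^{-η PH}` up to a second-order error in `η` (`lintegral_rpow_mul_exp_le`). For small `η` half of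
`δ` survives, giving `PU ≤ e^{η(-δ/2 + K 𝕀_D)} U`, and `U` is bounded on `D`. -/

/-! ### Kernel powers, absorption and reaching `C` -/

/-- Chapman-Kolmogorov, conditioning on the first step. -/
lemma kernel_pow_succ_apply (P : Kernel X X) (n : ℕ) (x : X) {A : Set X} (hA : MeasurableSet A) :
    (P ^ (n + 1)) x A = ∫⁻ y, (P ^ n) y A ∂(P x) := by
  rw [add_comm, Kernel.pow_add_apply_eq_lintegral P 1 n x hA, pow_one]

lemma kernel_pow_zero_apply (P : Kernel X X) (x : X) {A : Set X} (hA : MeasurableSet A) :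
    (P ^ 0) x A = A.indicator 1 x := by
  rw [pow_zero]
  exact Measure.dirac_apply' x hA

lemma kernel_pow_apply_le_one (P : Kernel X X) [IsMarkovKernel P] (n : ℕ) (x : X) {A : Set X}
    (hA : MeasurableSet A) : (P ^ n) x A ≤ 1 := by
  induction n generalizing x with
  | zero =>
    rw [kernel_pow_zero_apply P x hA]
    exact Set.indicator_le_self' (fun _ _ => zero_le) x |>.trans_eq rfl
  | succ n ih =>
    rw [kernel_pow_succ_apply P n x hA]
    calc _ ≤ ∫⁻ _, 1 ∂(P x) := lintegral_mono fun y => ih y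
      _ = 1 := by simp

lemma kernel_pow_apply_compl_eq_zero (P : Kernel X X) {S : Set X} (hS : MeasurableSet S)
    (h : ∀ x ∈ S, P x Sᶜ = 0) (n : ℕ) {x : X} (hx : x ∈ S) : (P ^ n) x Sᶜ = 0 := by
  induction n generalizing x with
  | zero => rw [kernel_pow_zero_apply P x hS.compl]; simp [hx]
  | succ n ih =>
    rw [kernel_pow_succ_apply P n x hS.compl,
      lintegral_eq_zero_iff ((P ^ n).measurable_coe hS.compl)]
    have : ∀ᵐ y ∂(P x), y ∈ S := h x hx
    filter_upwards [this] with y hy using ih hy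

/-- A strict geometric drift outside `C` for a finite weight bounded below forces the chain to
reach `C`. -/
lemma exists_kernel_pow_apply_pos (P : Kernel X X) [IsMarkovKernel P] {W : X → ℝ≥0∞}
    (hW : Measurable W) (hW1 : ∀ x, 1 ≤ W x) {C : Set X} (hC : MeasurableSet C) {ρ : ℝ≥0∞}
    (hρ : ρ < 1) (hS : ∀ x, W x < ∞ → P x {y | W y < ∞}ᶜ = 0)
    (h : ∀ x, W x < ∞ → x ∉ C → ∫⁻ y, W y ∂(P x) ≤ ρ * W x) {x : X} (hx : W x < ∞) :
    ∃ t : ℕ, 0 < (P ^ t) x C := by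
  by_contra! hcon
  -- Almost every successor of a point that never reaches `C` also never reaches `C`, so the drift
  -- can be iterated; `ρ ^ n * W x → 0` is then absurd.
  have key : ∀ (n : ℕ) (x : X), W x < ∞ → (∀ t : ℕ, (P ^ t) x C = 0) → 1 ≤ ρ ^ n * W x := by
    intro n
    induction n with
    | zero => intro x _ _; simpa using hW1 x
    | succ n ih =>
      intro x hx hxC
      have hxC' : x ∉ C := by
        intro hmem
        have h0 := hxC 0
        rw [kernel_pow_zero_apply P x hC] at h0
        simp [hmem] at h0
      have h1 : ∀ᵐ y ∂(P x), W y < ∞ := hS x hx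
      have h2 : ∀ᵐ y ∂(P x), ∀ t : ℕ, (P ^ t) y C = 0 := by
        refine ae_all_iff.2 fun t => ?_
        have := hxC (t + 1)
        rw [kernel_pow_succ_apply P t x hC,
          lintegral_eq_zero_iff ((P ^ t).measurable_coe hC)] at this
        filter_upwards [this] with y hy using hy
      calc (1 : ℝ≥0∞) = ∫⁻ _, 1 ∂(P x) := by simp
        _ ≤ ∫⁻ y, ρ ^ n * W y ∂(P x) := by
          refine lintegral_mono_ae ?_
          filter_upwards [h1, h2] with y hy1 hy2 using ih y hy1 hy2
        _ = ρ ^ n * ∫⁻ y, W y ∂(P x) := lintegral_const_mul _ hW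
        _ ≤ ρ ^ n * (ρ * W x) := by gcongr; exact h x hx hxC'
        _ = ρ ^ (n + 1) * W x := by ring
  have hlim : Tendsto (fun n : ℕ => ρ ^ n * W x) atTop (𝓝 (0 * W x)) :=
    ENNReal.Tendsto.mul_const (ENNReal.tendsto_pow_atTop_nhds_zero_of_lt_one hρ) (Or.inr hx.ne)
  have := ge_of_tendsto' hlim fun n => key n x hx fun t => le_antisymm (hcon t) zero_le
  simp at this

/-! ### Transfer of smallness -/

lemma lintegral_weighted_tsum_kernel_pow (P : Kernel X X) (m : ℕ → ℝ≥0∞) (n : ℕ) (x : X)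
    {A : Set X} (hA : MeasurableSet A) :
    ∑' t, m t * (P ^ (n + t)) x A = ∫⁻ y, ∑' t, m t * (P ^ t) y A ∂((P ^ n) x) := by
  rw [lintegral_tsum fun t => (((P ^ t).measurable_coe hA).const_mul _).aemeasurable]
  refine tsum_congr fun t => ?_
  rw [lintegral_const_mul _ ((P ^ t).measurable_coe hA),
    Kernel.pow_add_apply_eq_lintegral P n t x hA]

lemma tsum_shift_mul (m f : ℕ → ℝ≥0∞) (n : ℕ) :
    ∑' t, (if n ≤ t then m (t - n) else 0) * f t = ∑' t, m t * f (t + n) := by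
  rw [← (add_left_injective n).tsum_eq]
  · simp
  · intro t ht
    by_cases h : n ≤ t
    · exact ⟨t - n, Nat.sub_add_cancel h⟩
    · simp [h] at ht

/-- Points from which a small set is reached at a fixed time with probability bounded below
form a small set. -/
lemma IsSmallSet.of_le_kernel_pow {P : Kernel X X} {C : Set X} (hC : IsSmallSet P C) {A : Set X}
    (hA : MeasurableSet A) (n : ℕ) {c : ℝ≥0} (hc : 0 < c) (h : ∀ x ∈ A, c ≤ (P ^ n) x C) :
    IsSmallSet P A := by
  obtain ⟨hCm, ε, hε, ν, -, hν, m, hm, hm', hle⟩ := hC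
  -- The sampling time is delayed by `n`: run `n` steps to enter `C`, then sample with `m`. The mean
  -- grows by `n * ∑ m`.
  refine ⟨hA, c * ε, by positivity, ν, measurable_const.indicator hA, hν,
    fun t => if n ≤ t then m (t - n) else 0, ?_, ?_, ?_⟩
  · simpa using (tsum_shift_mul m (fun _ => 1) n).trans_lt (by simpa using hm)
  · have h2 := tsum_shift_mul m (fun t => (t : ℝ≥0∞)) n
    simp only [Nat.cast_add, mul_add] at h2
    simp only [mul_comm (Nat.cast _ : ℝ≥0∞)] at hm' ⊢
    rw [h2, ENNReal.tsum_add, ENNReal.tsum_mul_right]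
    exact ENNReal.add_lt_top.2 ⟨hm', ENNReal.mul_lt_top hm (by simp)⟩
  · intro x B hB
    rw [tsum_shift_mul m (fun t => (P ^ t) x B) n]
    by_cases hx : x ∈ A
    · simp only [add_comm _ n]
      rw [lintegral_weighted_tsum_kernel_pow P m n x hB, Set.indicator_of_mem hx]
      calc ((c * ε : ℝ≥0) : ℝ≥0∞) * ν B ≤ (P ^ n) x C * (ε * ν B) := by
            push_cast
            rw [mul_assoc]
            gcongr
            exact h x hx
        _ = ∫⁻ y, C.indicator (fun _ => ε * ν B) y ∂((P ^ n) x) := by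
            rw [lintegral_indicator_const hCm, mul_comm]
        _ ≤ _ := by
            refine lintegral_mono fun y => le_trans ?_ (hle y B hB)
            by_cases hy : y ∈ C <;> simp [hy]
    · simp [hx]

/-! ### Occupation times -/

/-- The expected occupation time of `A`, up to an independent random time with weights `m`. -/
noncomputable def occupation (P : Kernel X X) (m : ℕ → ℝ≥0∞) (A : Set X) (x : X) : ℝ≥0∞ :=
  ∑' t, m t * ∑ k ∈ Finset.range t, (P ^ k) x A

lemma measurable_occupation (P : Kernel X X) (m : ℕ → ℝ≥0∞) {A : Set X} (hA : MeasurableSet A) :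
    Measurable (occupation P m A) :=
  Measurable.tsum fun _ =>
    (Finset.measurable_fun_sum _ fun k _ => (P ^ k).measurable_coe hA).const_mul _

lemma occupation_le (P : Kernel X X) [IsMarkovKernel P] (m : ℕ → ℝ≥0∞) {A : Set X}
    (hA : MeasurableSet A) (x : X) : occupation P m A x ≤ ∑' t : ℕ, (t : ℝ≥0∞) * m t := by
  refine ENNReal.tsum_le_tsum fun t => ?_
  rw [mul_comm]
  gcongr
  calc _ ≤ ∑ _k ∈ Finset.range t, (1 : ℝ≥0∞) :=
        Finset.sum_le_sum fun k _ => kernel_pow_apply_le_one P k x hA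
    _ = t := by simp

/-- Telescoping: `P` shifts the sum over `k < t` to `1 ≤ k ≤ t`, and the indicator supplies the
missing term `k = 0`. Stated additively to avoid subtraction in `ℝ≥0∞`. -/
lemma lintegral_occupation_add (P : Kernel X X) (m : ℕ → ℝ≥0∞) {A : Set X}
    (hA : MeasurableSet A) (x : X) :
    ∫⁻ y, occupation P m A y ∂(P x) + (∑' t, m t) * A.indicator 1 x =
      occupation P m A x + ∑' t, m t * (P ^ t) x A := by
  unfold occupation
  rw [lintegral_tsum fun t => ((Finset.measurable_fun_sum _ fun k _ =>
    (P ^ k).measurable_coe hA).const_mul _).aemeasurable, ← ENNReal.tsum_mul_right,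
    ← ENNReal.tsum_add, ← ENNReal.tsum_add]
  refine tsum_congr fun t => ?_
  rw [lintegral_const_mul _ (Finset.measurable_fun_sum _ fun k _ => (P ^ k).measurable_coe hA),
    lintegral_finsetSum _ fun k _ => (P ^ k).measurable_coe hA, ← mul_add, ← mul_add,
    ← Finset.sum_range_succ, Finset.sum_range_succ', kernel_pow_zero_apply P x hA]
  simp only [kernel_pow_succ_apply P _ x hA]

/-! ### Hölder estimate for a tilted weight -/

/-- Hölder's inequality combined with a second-order expansion: perturbation of a weight by a
bounded factor. -/
lemma lintegral_rpow_mul_exp_le {μ : Measure X} [IsProbabilityMeasure μ] {W : X → ℝ≥0∞}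
    (hW : Measurable W) {H : X → ℝ} (hH : Measurable H) {B : ℝ} (h0 : ∀ x, 0 ≤ H x)
    (hB : ∀ x, H x ≤ B) {η : ℝ} (hη : 0 < η) (hη' : η ≤ 1 / 2) :
    ∫⁻ y, W y ^ η * ENNReal.ofReal (Real.exp (-(η * H y))) ∂μ ≤
      (∫⁻ y, W y ∂μ) ^ η *
        ENNReal.ofReal (Real.exp (η * (2 * η * B ^ 2 - ∫ y, H y ∂μ))) := by
  -- Chosen so that `e^{-ηH} = (e^{-θH})^{1-η}`, as Hölder with exponents `1/η` and `1/(1-η)`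
  -- requires.
  set θ := η / (1 - η) with hθ
  have h1η : 0 < 1 - η := by linarith
  have hθ0 : 0 < θ := by positivity
  have hθη : θ * (1 - η) = η := by rw [hθ]; field_simp
  have hθ2 : θ ≤ 2 * η := by rw [hθ, div_le_iff₀ h1η]; nlinarith
  have hHint : Integrable H μ := by
    refine Integrable.of_bound hH.aestronglyMeasurable B (ae_of_all _ fun x => ?_)
    rw [Real.norm_of_nonneg (h0 x)]; exact hB x
  have hexp : ∀ y, Real.exp (-(θ * H y)) ≤ 1 - θ * H y + θ ^ 2 * B ^ 2 := by
    intro y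
    have hx : 0 ≤ θ * H y := mul_nonneg hθ0.le (h0 y)
    -- For `u ≥ 0`, `(1 + u)(1 - u + u²) = 1 + u³ ≥ 1` and `e^u ≥ 1 + u`.
    have h1 : Real.exp (-(θ * H y)) ≤ 1 - θ * H y + (θ * H y) ^ 2 := by
      rw [Real.exp_neg]
      refine inv_le_of_inv_le₀ (by nlinarith [sq_nonneg (θ * H y - 1)]) ?_
      refine le_trans ?_ (Real.add_one_le_exp _)
      rw [inv_le_iff_one_le_mul₀ (by nlinarith [sq_nonneg (θ * H y - 1)])]
      nlinarith [pow_nonneg hx 3]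
    have h2 : H y ^ 2 ≤ B ^ 2 := pow_le_pow_left₀ (h0 y) (hB y) 2
    nlinarith [mul_le_mul_of_nonneg_left h2 (sq_nonneg θ)]
  have hg : ∫⁻ y, ENNReal.ofReal (Real.exp (-(θ * H y))) ∂μ ≤
      ENNReal.ofReal (Real.exp (θ ^ 2 * B ^ 2 - θ * ∫ y, H y ∂μ)) := by
    have hint : Integrable (fun y => 1 - θ * H y + θ ^ 2 * B ^ 2) μ :=
      ((integrable_const _).sub (hHint.const_mul θ)).add (integrable_const _)
    calc _ ≤ ∫⁻ y, ENNReal.ofReal (1 - θ * H y + θ ^ 2 * B ^ 2) ∂μ :=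
          lintegral_mono fun y => ENNReal.ofReal_le_ofReal (hexp y)
      _ = ENNReal.ofReal (∫ y, (1 - θ * H y + θ ^ 2 * B ^ 2) ∂μ) :=
          (ofReal_integral_eq_lintegral_ofReal hint
            (ae_of_all _ fun y => (Real.exp_pos _).le.trans (hexp y))).symm
      _ ≤ _ := by
          refine ENNReal.ofReal_le_ofReal ?_
          have h3 : ∫ y, (1 - θ * H y + θ ^ 2 * B ^ 2) ∂μ =
              1 - θ * ∫ y, H y ∂μ + θ ^ 2 * B ^ 2 := by
            have h4 : Integrable (fun y => 1 - θ * H y) μ :=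
              (integrable_const _).sub (hHint.const_mul θ)
            rw [integral_add h4 (integrable_const _),
              integral_sub (integrable_const _) (hHint.const_mul θ), integral_const_mul]
            simp only [integral_const, probReal_univ, one_smul]
          rw [h3]
          have := Real.add_one_le_exp (θ ^ 2 * B ^ 2 - θ * ∫ y, H y ∂μ)
          linarith
  have hpow : ∀ r : ℝ, ENNReal.ofReal (Real.exp r) ^ (1 - η) =
      ENNReal.ofReal (Real.exp (r * (1 - η))) := fun r => by
    rw [ENNReal.ofReal_rpow_of_pos (Real.exp_pos _), ← Real.exp_mul]
  calc ∫⁻ y, W y ^ η * ENNReal.ofReal (Real.exp (-(η * H y))) ∂μ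
      = ∫⁻ y, W y ^ η * ENNReal.ofReal (Real.exp (-(θ * H y))) ^ (1 - η) ∂μ := by
        refine lintegral_congr fun y => ?_
        rw [hpow, neg_mul, mul_right_comm, hθη]
    _ ≤ (∫⁻ y, W y ∂μ) ^ η * (∫⁻ y, ENNReal.ofReal (Real.exp (-(θ * H y))) ∂μ) ^ (1 - η) := by
        refine ENNReal.lintegral_mul_norm_pow_le hW.aemeasurable ?_ hη.le h1η.le (by ring)
        exact (Real.measurable_exp.comp (hH.const_mul θ).neg).ennreal_ofReal.aemeasurable
    _ ≤ (∫⁻ y, W y ∂μ) ^ η *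
          ENNReal.ofReal (Real.exp (θ ^ 2 * B ^ 2 - θ * ∫ y, H y ∂μ)) ^ (1 - η) := by gcongr
    _ ≤ _ := by
        have : (θ ^ 2 * B ^ 2 - θ * ∫ y, H y ∂μ) * (1 - η) =
            η * (θ * B ^ 2 - ∫ y, H y ∂μ) := by
          linear_combination (θ * B ^ 2 - ∫ y, H y ∂μ) * hθη
        rw [hpow, this]
        gcongr

/-! ### A small set with bounded weight -/

lemma measure_compl_finite_eq_zero (P : Kernel X X) {W : X → ℝ≥0∞} (hW : Measurable W) {x : X}
    (h : ∫⁻ y, W y ∂(P x) < ∞) : P x {y | W y < ∞}ᶜ = 0 :=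
  ae_lt_top hW h.ne

lemma lintegral_exp_le_of_nonlinearGenerator_le {P : Kernel X X} {V : X → ℝ≥0∞} {x : X}
    (hx : V x < ∞) {r : ℝ} (h : nonlinearGenerator P V x ≤ (r : EReal)) :
    ∫⁻ y, EReal.exp (V y) ∂(P x) ≤ ENNReal.ofReal (Real.exp r) * EReal.exp (V x) := by
  have h1 := EReal.exp_le_exp_iff.2 h
  rw [nonlinearGenerator, ENNReal.exp_log, EReal.exp_neg, EReal.exp_coe] at h1
  have h2 : EReal.exp (V x) ≠ 0 := by simp
  have h3 : EReal.exp (V x) ≠ ∞ := by simpa using hx.ne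
  rwa [mul_comm, ← div_eq_mul_inv, ENNReal.div_le_iff h2 h3] at h1

lemma measurableSet_finite {W : X → ℝ≥0∞} (hW : Measurable W) :
    MeasurableSet {x | W x < ∞} :=
  measurableSet_lt hW measurable_const

/-- A small set reached from all points where the weight is finite can be traded for a small set
on which the weight is bounded. -/
lemma exists_small_bounded {P : Kernel X X} [IsMarkovKernel P] {W : X → ℝ≥0∞}
    (hW : Measurable W) {C : Set X} (hC : IsSmallSet P C)
    (hS : ∀ x, W x < ∞ → P x {y | W y < ∞}ᶜ = 0)
    (hreach : ∀ x, W x < ∞ → ∃ t : ℕ, 0 < (P ^ t) x C) (hx₀ : ∃ x, W x < ∞) :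
    ∃ D, IsSmallSet P D ∧ (∃ r : ℝ≥0, ∀ x ∈ D, W x ≤ r) ∧
      ∃ (κ : ℝ≥0) (m : ℕ → ℝ≥0∞), 0 < κ ∧ (∑' t, m t) < ∞ ∧
        (∑' t : ℕ, (t : ℝ≥0∞) * m t) < ∞ ∧
        ∀ x ∈ C, κ ≤ ∑' t, m t * (P ^ t) x D := by
  obtain ⟨hCm, ε, hε, ν, -, hν, m, hm, hm', hle⟩ := id hC
  have hSm := measurableSet_finite hW
  have hpow : ∀ n x, W x < ∞ → (P ^ n) x {y | W y < ∞}ᶜ = 0 := fun n x hx =>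
    kernel_pow_apply_compl_eq_zero P hSm (fun x hx => hS x hx) n hx
  -- The absorbing set `{W < ∞}` meets `C`; minorization at a common point leaves `ν` no mass
  -- outside it.
  have hνS : ν {y | W y < ∞}ᶜ = 0 := by
    obtain ⟨x, hx⟩ := hx₀
    obtain ⟨t, ht⟩ := hreach x hx
    obtain ⟨y, hyS, hyC⟩ : ∃ y, W y < ∞ ∧ y ∈ C := by
      by_contra! hcon
      refine ht.ne' (measure_mono_null ?_ (hpow t x hx))
      intro y hy hyS
      exact hcon y hyS hy
    have h1 := hle y _ hSm.compl
    simp only [hpow _ y hyS, mul_zero, tsum_zero, Set.indicator_of_mem hyC, nonpos_iff_eq_zero,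
      mul_eq_zero, ENNReal.coe_eq_zero, hε.ne', false_or] at h1
    exact h1
  let D : ℕ × ℕ → Set X := fun p =>
    {x | ((p.2 + 1 : ℝ≥0)⁻¹ : ℝ≥0) ≤ (P ^ p.1) x C} ∩ {x | W x ≤ (p.2 : ℝ≥0)}
  have hDm : ∀ p, MeasurableSet (D p) := fun p =>
    (measurableSet_le measurable_const ((P ^ p.1).measurable_coe hCm)).inter
      (measurableSet_le hW measurable_const)
  have hcover : {y | W y < ∞} ⊆ ⋃ p, D p := by
    intro x hx
    obtain ⟨t, ht⟩ := hreach x hx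
    obtain ⟨j, hj⟩ := ENNReal.exists_inv_nat_lt ht.ne'
    obtain ⟨k, hk⟩ := ENNReal.exists_nat_gt (show W x < ∞ from hx).ne
    refine Set.mem_iUnion.2 ⟨(t, max j k), ?_, ?_⟩
    · show (((max j k : ℕ) + 1 : ℝ≥0)⁻¹ : ℝ≥0) ≤ (P ^ t) x C
      refine le_trans ?_ hj.le
      rw [ENNReal.coe_inv (by positivity)]
      refine ENNReal.inv_le_inv.2 ?_
      push_cast
      exact le_trans (le_max_left (j : ℝ≥0∞) k) le_self_add
    · show W x ≤ ((max j k : ℕ) : ℝ≥0)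
      refine hk.le.trans ?_
      exact_mod_cast le_max_right j k
  obtain ⟨p, hp⟩ : ∃ p, ν (D p) ≠ 0 := by
    by_contra! hcon
    have h1 : ν {y | W y < ∞} = 0 := measure_mono_null hcover (measure_iUnion_null hcon)
    have h2 := measure_add_measure_compl (μ := ν) hSm
    rw [h1, hνS, measure_univ] at h2
    simp at h2
  refine ⟨D p, hC.of_le_kernel_pow (hDm p) p.1 (c := (p.2 + 1 : ℝ≥0)⁻¹) (by positivity)
    fun x hx => hx.1, ⟨p.2, fun x hx => hx.2⟩, ε * (ν (D p)).toNNReal, m, ?_, hm, hm', ?_⟩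
  · exact mul_pos hε (ENNReal.toNNReal_pos hp (measure_ne_top ν _))
  · intro x hx
    have := hle x (D p) (hDm p)
    rw [Set.indicator_of_mem hx] at this
    rwa [ENNReal.coe_mul, ENNReal.coe_toNNReal (measure_ne_top ν _)]

/-! ### Bounded corrector and tilted drift -/

/-- A bounded function whose drift is at least `b` on `C`, up to a compensation on `D`. -/
lemma exists_bounded_drift {P : Kernel X X} [IsMarkovKernel P] {C D : Set X}
    (hD : MeasurableSet D) {κ : ℝ≥0} (hκ : 0 < κ) {m : ℕ → ℝ≥0∞}
    (hm : (∑' t, m t) < ∞) (hm' : (∑' t : ℕ, (t : ℝ≥0∞) * m t) < ∞)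
    (h : ∀ x ∈ C, κ ≤ ∑' t, m t * (P ^ t) x D) (b : ℝ) :
    ∃ (H : X → ℝ) (B K : ℝ), Measurable H ∧ (∀ x, 0 ≤ H x) ∧ (∀ x, H x ≤ B) ∧ 0 ≤ K ∧
      ∀ x, H x + C.indicator (fun _ => b) x - D.indicator (fun _ => K) x ≤ ∫ y, H y ∂(P x) := by
  set M := ∑' t : ℕ, (t : ℝ≥0∞) * m t
  set L := ∑' t, m t
  have hGm := measurable_occupation P m hD
  have hGM : ∀ x, occupation P m D x ≤ M := occupation_le P m hD
  have hGtop : ∀ x, occupation P m D x ≠ ∞ := fun x => ((hGM x).trans_lt hm').ne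
  -- Scales the gain `κ` on `C` up to `|b| ≥ b`.
  set k : ℝ := |b| / κ with hk
  have hκ' : (0 : ℝ) < κ := hκ
  have hk0 : 0 ≤ k := by positivity
  refine ⟨fun x => k * (occupation P m D x).toReal, k * M.toReal, k * L.toReal,
    hGm.ennreal_toReal.const_mul k, fun x => by positivity,
    fun x => mul_le_mul_of_nonneg_left (ENNReal.toReal_mono hm'.ne (hGM x)) hk0, by positivity, fun x => ?_⟩
  have hPG : ∫⁻ y, occupation P m D y ∂(P x) ≠ ∞ := by
    refine ((lintegral_mono fun y => hGM y).trans_lt ?_).ne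
    simpa using hm'
  have hint : ∫ y, k * (occupation P m D y).toReal ∂(P x) =
      k * (∫⁻ y, occupation P m D y ∂(P x)).toReal := by
    rw [integral_const_mul, integral_toReal hGm.aemeasurable
      (ae_of_all _ fun y => (hGtop y).lt_top)]
  rw [hint]
  have hCle : C.indicator (fun _ => (κ : ℝ≥0∞)) x ≤ ∑' t, m t * (P ^ t) x D :=
    Set.indicator_le' (fun x hx => h x hx) (fun _ _ => zero_le) x
  have key : occupation P m D x + C.indicator (fun _ => (κ : ℝ≥0∞)) x ≤
      ∫⁻ y, occupation P m D y ∂(P x) + D.indicator (fun _ => L) x := by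
    have h1 := lintegral_occupation_add P m hD x
    have h2 : L * D.indicator 1 x = D.indicator (fun _ => L) x := by
      by_cases hx : x ∈ D <;> simp [hx]
    rw [← h2, h1]
    gcongr
  have hLtop : D.indicator (fun _ => L) x ≠ ∞ := by
    by_cases hx : x ∈ D <;> simp [hx, hm.ne]
  have hκtop : C.indicator (fun _ => (κ : ℝ≥0∞)) x ≠ ∞ := by
    by_cases hx : x ∈ C <;> simp [hx]
  have keyR := ENNReal.toReal_mono (ENNReal.add_ne_top.2 ⟨hPG, hLtop⟩) key
  rw [ENNReal.toReal_add (hGtop x) hκtop, ENNReal.toReal_add hPG hLtop] at keyR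
  have keyk := mul_le_mul_of_nonneg_left keyR hk0
  rw [mul_add, mul_add] at keyk
  have h3 : C.indicator (fun _ => b) x ≤ k * (C.indicator (fun _ => (κ : ℝ≥0∞)) x).toReal := by
    by_cases hx : x ∈ C
    · simp only [hx, Set.indicator_of_mem, ENNReal.coe_toReal, hk]
      rw [div_mul_cancel₀ _ hκ'.ne']
      exact le_abs_self b
    · simp [hx]
  have h4 : D.indicator (fun _ => k * L.toReal) x = k * (D.indicator (fun _ => L) x).toReal := by
    by_cases hx : x ∈ D <;> simp [hx]
  rw [h4]
  linarith

/-- A multiplicative drift with an additive compensation yields the bound defining (V4). -/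
lemma generator_le_of_lintegral_le {P : Kernel X X} {U : X → ℝ≥0∞} {D : Set X} {δ b : ℝ}
    (hδ : δ ≤ 1) (hb : 0 ≤ b) {x : X} (hx : U x < ∞)
    (h : ∫⁻ y, U y ∂(P x) ≤
      ENNReal.ofReal (1 - δ) * U x + D.indicator (fun _ => ENNReal.ofReal b) x) :
    generator P U x ≤
      ((-δ : ℝ) : EReal) * (U x : EReal) + ((D.indicator (fun _ => b) x : ℝ) : EReal) := by
  have hDe : D.indicator (fun _ => ENNReal.ofReal b) x =
      ENNReal.ofReal (D.indicator (fun _ => b) x) := by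
    by_cases hx : x ∈ D <;> simp [hx]
  have hD0 : 0 ≤ D.indicator (fun _ => b) x := Set.indicator_nonneg (fun _ _ => hb) x
  rw [hDe] at h
  generalize D.indicator (fun _ => b) x = d at h hD0 ⊢
  unfold generator
  generalize ∫⁻ y, U y ∂(P x) = I at h ⊢
  generalize U x = u at h hx ⊢
  have hI : I ≠ ∞ := by
    refine (h.trans_lt ?_).ne
    exact ENNReal.add_lt_top.2 ⟨ENNReal.mul_lt_top ENNReal.ofReal_lt_top hx,
      ENNReal.ofReal_lt_top⟩
  lift u to ℝ≥0 using hx.ne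
  lift I to ℝ≥0 using hI
  have h' : (I : ℝ) ≤ (1 - δ) * u + d := by
    have := ENNReal.toReal_mono (by finiteness) h
    rwa [ENNReal.toReal_add (by finiteness) (by finiteness), ENNReal.toReal_mul,
      ENNReal.toReal_ofReal (by linarith), ENNReal.toReal_ofReal hD0] at this
  have e : ∀ a : ℝ≥0, (((a : ℝ≥0∞)) : EReal) = ((a : ℝ) : EReal) := fun _ => rfl
  rw [e, e, ← EReal.coe_sub, ← EReal.coe_mul, ← EReal.coe_add, EReal.coe_le_coe_iff]
  linarith

/-- Tilting the power `W ^ η` of a weight with multiplicative drift by a bounded function. -/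
lemma lintegral_tilted_rpow_le {P : Kernel X X} [IsMarkovKernel P] {W : X → ℝ≥0∞}
    (hW : Measurable W) {H : X → ℝ} (hH : Measurable H) {B : ℝ} (h0 : ∀ x, 0 ≤ H x)
    (hB : ∀ x, H x ≤ B) {η : ℝ} (hη : 0 < η) (hη' : η ≤ 1 / 2) {x : X} {a e : ℝ}
    (hx : ∫⁻ y, W y ∂(P x) ≤ ENNReal.ofReal (Real.exp a) * W x)
    (he : a + 2 * η * B ^ 2 - ∫ y, H y ∂(P x) ≤ e - H x) :
    ∫⁻ y, W y ^ η * ENNReal.ofReal (Real.exp (η * (B - H y))) ∂(P x) ≤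
      ENNReal.ofReal (Real.exp (η * e)) *
        (W x ^ η * ENNReal.ofReal (Real.exp (η * (B - H x)))) := by
  have hmul : ∀ r s : ℝ, ENNReal.ofReal (Real.exp r) * ENNReal.ofReal (Real.exp s) =
      ENNReal.ofReal (Real.exp (r + s)) := fun r s => by
    rw [Real.exp_add, ENNReal.ofReal_mul (Real.exp_pos _).le]
  have hmeas : Measurable fun y => W y ^ η * ENNReal.ofReal (Real.exp (-(η * H y))) :=
    (hW.pow_const η).mul (Real.measurable_exp.comp (hH.const_mul η).neg).ennreal_ofReal
  calc _ = ∫⁻ y, ENNReal.ofReal (Real.exp (η * B)) *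
          (W y ^ η * ENNReal.ofReal (Real.exp (-(η * H y)))) ∂(P x) := by
        refine lintegral_congr fun y => ?_
        rw [mul_left_comm, hmul]
        ring_nf
    _ = ENNReal.ofReal (Real.exp (η * B)) *
          ∫⁻ y, W y ^ η * ENNReal.ofReal (Real.exp (-(η * H y))) ∂(P x) :=
        lintegral_const_mul _ hmeas
    _ ≤ ENNReal.ofReal (Real.exp (η * B)) * ((∫⁻ y, W y ∂(P x)) ^ η *
          ENNReal.ofReal (Real.exp (η * (2 * η * B ^ 2 - ∫ y, H y ∂(P x))))) := by
        gcongr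
        exact lintegral_rpow_mul_exp_le hW hH h0 hB hη hη'
    _ ≤ ENNReal.ofReal (Real.exp (η * B)) * ((ENNReal.ofReal (Real.exp a) * W x) ^ η *
          ENNReal.ofReal (Real.exp (η * (2 * η * B ^ 2 - ∫ y, H y ∂(P x))))) := by
        gcongr
    _ = ENNReal.ofReal (Real.exp (η * B + (a * η +
          η * (2 * η * B ^ 2 - ∫ y, H y ∂(P x))))) * W x ^ η := by
        rw [ENNReal.mul_rpow_of_nonneg _ _ hη.le, ENNReal.ofReal_rpow_of_pos (Real.exp_pos _),
          ← Real.exp_mul, ← hmul, ← hmul]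
        ring
    _ ≤ ENNReal.ofReal (Real.exp (η * e + η * (B - H x))) * W x ^ η := by
        gcongr ENNReal.ofReal (Real.exp ?_) * _
        have := mul_le_mul_of_nonneg_left he hη.le
        linarith
    _ = _ := by
        rw [← hmul]
        ring

lemma expWeight_eq_rpow {Y : Type*} (η : ℝ) (V : Y → ℝ≥0∞) (x : Y) :
    expWeight η V x = EReal.exp (V x) ^ η := by
  rw [expWeight, mul_comm, EReal.exp_mul]

end MultDrift

/-! ### Assembly -/

open MultDrift

theorem mainTheorem9 {X : Type*} [TopologicalSpace X] [PolishSpace X] [MeasurableSpace X]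
    [BorelSpace X] (P : Kernel X X) [IsMarkovKernel P] (ψ : Measure X)
    (hP : MultDrift.IsPsiIrreducibleAperiodic P ψ)
    (V : X → ℝ≥0∞) (hV : MultDrift.DV2 P V) :
    ∃ η : ℝ, 0 < η ∧ ∃ V₀ : X → ℝ≥0∞, MultDrift.V4 P ψ V₀ ∧
      MultDrift.MemLInftyWeighted (MultDrift.expWeight η V) V₀ ∧
      MultDrift.MemLInftyWeighted V₀ (MultDrift.expWeight η V) := by
  obtain ⟨hVm, -, ⟨x₀, hx₀⟩, C, δ, b, hC, hδ, hdrift⟩ := hV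
  set W : X → ℝ≥0∞ := fun x => EReal.exp (V x) with hWdef
  have hW : Measurable W := hVm.coe_ereal_ennreal.ereal_exp
  have hW1 : ∀ x, 1 ≤ W x := fun x => EReal.one_le_exp_iff.2 (EReal.coe_ennreal_nonneg _)
  have hWV : ∀ x, W x < ∞ ↔ V x < ∞ := fun x => by
    simp [hWdef, lt_top_iff_ne_top]
  have hPW : ∀ x, W x < ∞ → ∫⁻ y, W y ∂(P x) ≤
      ENNReal.ofReal (Real.exp (-δ + C.indicator (fun _ => b) x)) * W x := fun x hx =>
    lintegral_exp_le_of_nonlinearGenerator_le ((hWV x).1 hx) (hdrift x ((hWV x).1 hx))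
  have hS : ∀ x, W x < ∞ → P x {y | W y < ∞}ᶜ = 0 := fun x hx =>
    measure_compl_finite_eq_zero P hW
      ((hPW x hx).trans_lt (ENNReal.mul_lt_top ENNReal.ofReal_lt_top hx))
  have hSm := measurableSet_finite hW
  have hreach : ∀ x, W x < ∞ → ∃ t : ℕ, 0 < (P ^ t) x C := fun x hx => by
    refine exists_kernel_pow_apply_pos P hW hW1 hC.1 (ρ := ENNReal.ofReal (Real.exp (-δ)))
      ?_ hS ?_ hx
    · rw [ENNReal.ofReal_lt_one, Real.exp_lt_one_iff]
      linarith
    · intro y hy hyC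
      simpa [hyC] using hPW y hy
  have hψ : ∀ᵐ x ∂ψ, W x < ∞ := by
    change ψ {y | W y < ∞}ᶜ = 0
    by_contra hne
    obtain ⟨t, ht⟩ := (hP.eventually_pos _ hSm.compl (pos_iff_ne_zero.2 hne) x₀).exists
    exact ht.ne' (kernel_pow_apply_compl_eq_zero P hSm (fun x hx => hS x hx) t
      ((hWV x₀).2 hx₀))
  obtain ⟨D, hD, ⟨r, hr⟩, κ, m, hκ, hm, hm', hle⟩ :=
    exists_small_bounded hW hC hS hreach ⟨x₀, (hWV x₀).2 hx₀⟩
  obtain ⟨H, B, K, hH, hH0, hHB, hK, hHdrift⟩ := exists_bounded_drift hD.1 hκ hm hm' hle b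
  -- The second-order Hölder error may cost at most half of `δ`.
  obtain ⟨η, hη, hη', hηδ⟩ : ∃ η : ℝ, 0 < η ∧ η ≤ 1 / 2 ∧ 2 * η * B ^ 2 ≤ δ / 2 := by
    refine ⟨min (1 / 2) (δ / (4 * (B ^ 2 + 1))), by positivity, min_le_left _ _, ?_⟩
    have h1 := min_le_right (1 / 2) (δ / (4 * (B ^ 2 + 1)))
    rw [le_div_iff₀ (by positivity)] at h1
    have h2 : 0 < min (1 / 2) (δ / (4 * (B ^ 2 + 1))) := by positivity
    linarith
  set U : X → ℝ≥0∞ := fun x => W x ^ η * ENNReal.ofReal (Real.exp (η * (B - H x))) with hU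
  have hUW : ∀ x, U x ≤ ENNReal.ofReal (Real.exp (η * B)) * W x ^ η := fun x => by
    rw [hU, mul_comm]
    dsimp only
    gcongr
    linarith [hH0 x]
  have hWU : ∀ x, W x ^ η ≤ U x := fun x => by
    refine le_mul_of_one_le_right' ?_
    rw [ENNReal.one_le_ofReal, Real.one_le_exp_iff]
    exact mul_nonneg hη.le (sub_nonneg.2 (hHB x))
  have hUfin : ∀ x, W x < ∞ → U x < ∞ := fun x hx =>
    ENNReal.mul_lt_top (ENNReal.rpow_lt_top_of_nonneg hη.le hx.ne) ENNReal.ofReal_lt_top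
  have hWfin : ∀ x, U x < ∞ → W x < ∞ := fun x hx =>
    (ENNReal.rpow_lt_top_iff_of_pos hη).1 ((hWU x).trans_lt hx)
  have hPU : ∀ x, W x < ∞ → ∫⁻ y, U y ∂(P x) ≤
      ENNReal.ofReal (Real.exp (η * (-(δ / 2) + D.indicator (fun _ => K) x))) * U x :=
    fun x hx => lintegral_tilted_rpow_le hW hH hH0 hHB hη hη' (hPW x hx)
      (by linarith [hHdrift x])
  have hηδ0 : 0 < η * (δ / 2) := by positivity
  refine ⟨η, hη, U, ⟨?_, ?_, ?_, D, 1 - Real.exp (-(η * (δ / 2))),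
    Real.exp (η * K) * (Real.exp (η * B) * (r : ℝ) ^ η), hD, ?_, ?_⟩, ?_, ?_⟩
  · exact (hW.pow_const η).mul
      (Real.measurable_exp.comp ((measurable_const.sub hH).const_mul η)).ennreal_ofReal
  · exact fun x => (ENNReal.one_le_rpow (hW1 x) hη).trans (hWU x)
  · filter_upwards [hψ] with x hx using hUfin x hx
  · rw [sub_pos, Real.exp_lt_one_iff]
    linarith
  · intro x hx
    refine generator_le_of_lintegral_le (by linarith [Real.exp_pos (-(η * (δ / 2)))])
      (by positivity) hx ((hPU x (hWfin x hx)).trans ?_)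
    by_cases hxD : x ∈ D
    -- On `D` the additive constant alone suffices, since `W ≤ r` bounds `U`.
    · refine le_add_left ?_
      simp only [hxD, Set.indicator_of_mem]
      rw [ENNReal.ofReal_mul (Real.exp_pos _).le, ENNReal.ofReal_mul (Real.exp_pos _).le,
        ← ENNReal.ofReal_rpow_of_nonneg r.coe_nonneg hη.le, ENNReal.ofReal_coe_nnreal]
      gcongr
      · linarith
      · refine (hUW x).trans ?_
        gcongr
        exact hr x hxD
    · simp [hxD]
  · refine ⟨(Real.exp (η * B)).toNNReal, fun x => ?_⟩
    rw [expWeight_eq_rpow]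
    exact hUW x
  · refine ⟨1, fun x => ?_⟩
    rw [expWeight_eq_rpow, ENNReal.coe_one, one_mul]
    exact hWU x
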